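/- **Theorem (Cauchy matrix solutions).** Let $N\ge 0$, $e,g\in\mathbb C$ with $g\neq 0$, $n\in\mathbb Z$, and let $(k_\nu,K_\nu)$, $\nu=1,\dots,N$, be distinct points with $K_\nu\ne0$ on the curve $k^2=K+3e+\frac gK$ over $\mathbb C$, such that for $\mu\neq\nu$ the numbers $k_\mu+k_\nu$ and $1-\frac{g}{K_\mu K_\nu}$ do not both vanish. Let $(c_{\mu,\nu})$ be a complex constant $N\times N$ matrix with $c_{\mu,\nu}=-c_{\nu,\mu}$. Define $N\times N$ matrices $M$ and $R$ by $$M_{\mu,\nu}=\frac{K_\mu-K_\nu}{k_\mu+k_\nu}=\frac{k_\mu-k_\nu}{1-\frac{g}{K_\mu K_\nu}}$$ (the two expressions agree on the curve; the second is used if $k_\mu+k_\nu=0$, and $M_{\mu,\mu}=0$), $$R_{\mu,\nu}=c_{\nu,\mu}\,e^{\theta_\mu+\theta_\nu}\Big(\frac{K_\mu K_\nu}{g}\Big)^n,\qquad \theta_\nu=\sum_{j\ge0}k_\nu^{2j+1}x_{2j+1}+\sum_{j\ge1}\Big[K_\nu^j-\Big(\frac g{K_\nu}\Big)^j\Big]x_{2j},$$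 where $x=(x_1,x_2,x_3,\dots)$ are complex times for which all these series converge absolutely. Put $\boldsymbol k_0={}^t(1,\dots,1)$, $\boldsymbol k_1={}^t(k_1,\dots,k_N)$, $\boldsymbol k_2={}^t(K_1,\dots,K_N)$, $\boldsymbol k_3={}^t(k_1K_1,\dots,k_NK_N)$, and $$u_n=-{}^t\boldsymbol k_2(I+RM)^{-1}R\,\boldsymbol k_0,\quad v_n=1-g^{-1}\,{}^t\boldsymbol k_3(I+RM)^{-1}R\,\boldsymbol k_2,\quad w_n=1+{}^t\boldsymbol k_1(I+RM)^{-1}R\,\boldsymbol k_0 .$$ Then at every such $x$ with $\det(I+RM)\ne0$ these functions are analytic in $(x_1,x_2,x_3)$ and solve the elliptic coupled KP system $$\partial_3u_n=\tfrac14\partial_1^3u_n+\tfrac32(\partial_1u_n)^2+\tfrac34\partial_1^{-1}\partial_2^2u_n+3g(1-v_nw_n),$$ $$\partial_3v_n=-\tfrac12\partial_1^3v_n-3(\partial_1u_n-3e)\partial_1v_n+\tfrac32\partial_1\partial_2v_n+3(\partial_2u_n)v_n,$$ $$\partial_3w_n=-\tfrac12\partial_1^3w_n-3(\partial_1u_n-3e)\partial_1w_n-\tfrac32\partial_1\partial_2w_n-3(\partial_2u_n)w_n,$$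 where $\partial_j=\partial/\partial x_j$ and $\partial_1^{-1}\partial_2^2u_n$ is the following antiderivative of $\partial_2^2u_n$ with respect to $x_1$: with $\tau_n^2=\det(I+RM)$, the function $q_n=\partial_2^2\ln\tau_n=\partial_2\big(\tfrac{\partial_2\det(I+RM)}{2\det(I+RM)}\big)$ is analytic in $(x_1,x_2,x_3)$ at every such $x$ and satisfies $\partial_1q_n=\partial_2^2u_n$. -/

import Mathlib

open scoped Matrix

noncomputable section

namespace EllKP

/-- The partial derivative `∂ⱼ F` with respect to the time variable `xⱼ`, for a function `F` of the
sequence of times `x = (x₁, x₂, x₃, …)` (the entry `x 0` is never used). -/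
def pd (j : ℕ) (F : (ℕ → ℂ) → ℂ) : (ℕ → ℂ) → ℂ :=
  fun x => deriv (fun s : ℂ => F (Function.update x j s)) (x j)

/-- The times `x` with `x₁, x₂, x₃` replaced by `s 0, s 1, s 2`. -/
def setTimes (x : ℕ → ℂ) (s : Fin 3 → ℂ) : ℕ → ℂ :=
  Function.update (Function.update (Function.update x 1 (s 0)) 2 (s 1)) 3 (s 2)

/-- `F` is (jointly) analytic in `(x₁, x₂, x₃)` at the point `x`, the other times being fixed. -/
def AnalyticAtTimes (F : (ℕ → ℂ) → ℂ) (x : ℕ → ℂ) : Prop :=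
  AnalyticAt ℂ (fun s : Fin 3 → ℂ => F (setTimes x s)) ![x 1, x 2, x 3]

/-- The elliptic coupled KP system at the point `x`, where the function `q` plays the role of
`∂₁⁻¹ ∂₂² u`: it is an `x₁`-antiderivative of `∂₂² u`. All functions are required to be analytic
in `(x₁, x₂, x₃)` at `x`, so that every derivative below is a genuine one. -/
structure SolvesAt (e g : ℂ) (u v w q : (ℕ → ℂ) → ℂ) (x : ℕ → ℂ) : Prop where
  analytic_u : AnalyticAtTimes u x
  analytic_v : AnalyticAtTimes v x
  analytic_w : AnalyticAtTimes w x
  analytic_q : AnalyticAtTimes q x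
  antideriv : pd 1 q x = pd 2 (pd 2 u) x
  eq_u : pd 3 u x = 1 / 4 * pd 1 (pd 1 (pd 1 u)) x + 3 / 2 * (pd 1 u x) ^ 2
      + 3 / 4 * q x + 3 * g * (1 - v x * w x)
  eq_v : pd 3 v x = -(1 / 2) * pd 1 (pd 1 (pd 1 v)) x - 3 * (pd 1 u x - 3 * e) * pd 1 v x
      + 3 / 2 * pd 1 (pd 2 v) x + 3 * pd 2 u x * v x
  eq_w : pd 3 w x = -(1 / 2) * pd 1 (pd 1 (pd 1 w)) x - 3 * (pd 1 u x - 3 * e) * pd 1 w x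
      - 3 / 2 * pd 1 (pd 2 w) x - 3 * pd 2 u x * w x

/-- The skew-symmetric elliptic Cauchy kernel `Ω` at two points `(k, K)`, `(k', K')` of the curve
`k² = K + 3e + g/K`. On the curve the two expressions agree wherever both denominators are
nonzero; the second one is used where `k + k' = 0`. -/
def kernel (g k K k' K' : ℂ) : ℂ :=
  open Classical in
  if k + k' ≠ 0 then (K - K') / (k + k') else (k - k') / (1 - g / (K * K'))

/-- Both series in the exponent of the plane wave factor of the point `(k, K)` converge. -/
def PhaseSummable (g k K : ℂ) (x : ℕ → ℂ) : Prop :=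
  Summable (fun j : ℕ => k ^ (2 * j + 1) * x (2 * j + 1)) ∧
  Summable (fun j : ℕ => (K ^ (j + 1) - (g / K) ^ (j + 1)) * x (2 * (j + 1)))

/-- The exponent
`∑_{j ≥ 0} k^(2j+1) x_{2j+1} + ∑_{j ≥ 1} (K^j - (g/K)^j) x_{2j}` of the plane wave factor. -/
def phase (g k K : ℂ) (x : ℕ → ℂ) : ℂ :=
  (∑' j : ℕ, k ^ (2 * j + 1) * x (2 * j + 1)) +
    ∑' j : ℕ, (K ^ (j + 1) - (g / K) ^ (j + 1)) * x (2 * (j + 1))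

variable {N : ℕ}

/-- The elliptic Cauchy matrix `M`. -/
def matM (g : ℂ) (k K : Fin N → ℂ) : Matrix (Fin N) (Fin N) ℂ :=
  Matrix.of fun μ ν => kernel g (k μ) (K μ) (k ν) (K ν)

/-- The matrix `R`, with entries `c_{ν,μ} ρₙ(κ_ν) ρₙ(κ_μ)`. -/
def matR (g : ℂ) (k K : Fin N → ℂ) (c : Matrix (Fin N) (Fin N) ℂ) (n : ℤ) (x : ℕ → ℂ) :
    Matrix (Fin N) (Fin N) ℂ :=
  Matrix.of fun μ ν =>
    c ν μ * Complex.exp (phase g (k μ) (K μ) x + phase g (k ν) (K ν) x) * (K μ * K ν / g) ^ n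

/-- The matrix `I + R M`. -/
def matA (g : ℂ) (k K : Fin N → ℂ) (c : Matrix (Fin N) (Fin N) ℂ) (n : ℤ) (x : ℕ → ℂ) :
    Matrix (Fin N) (Fin N) ℂ :=
  1 + matR g k K c n x * matM g k K

def vec0 : Fin N → ℂ := fun _ => 1

def vec1 (k : Fin N → ℂ) : Fin N → ℂ := k

def vec2 (K : Fin N → ℂ) : Fin N → ℂ := K

def vec3 (k K : Fin N → ℂ) : Fin N → ℂ := fun ν => k ν * K ν

/-- `uₙ = -ᵗk₂ (I + R M)⁻¹ R k₀`. -/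
def solU (g : ℂ) (k K : Fin N → ℂ) (c : Matrix (Fin N) (Fin N) ℂ) (n : ℤ) (x : ℕ → ℂ) : ℂ :=
  -(vec2 K ⬝ᵥ ((matA g k K c n x)⁻¹ * matR g k K c n x) *ᵥ vec0)

/-- `vₙ = 1 - g⁻¹ ᵗk₃ (I + R M)⁻¹ R k₂`. -/
def solV (g : ℂ) (k K : Fin N → ℂ) (c : Matrix (Fin N) (Fin N) ℂ) (n : ℤ) (x : ℕ → ℂ) : ℂ :=
  1 - g⁻¹ * (vec3 k K ⬝ᵥ ((matA g k K c n x)⁻¹ * matR g k K c n x) *ᵥ vec2 K)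

/-- `wₙ = 1 + ᵗk₁ (I + R M)⁻¹ R k₀`. -/
def solW (g : ℂ) (k K : Fin N → ℂ) (c : Matrix (Fin N) (Fin N) ℂ) (n : ℤ) (x : ℕ → ℂ) : ℂ :=
  1 + vec1 k ⬝ᵥ ((matA g k K c n x)⁻¹ * matR g k K c n x) *ᵥ vec0

/-- The square `τₙ² = det (I + R M)` of the tau function. -/
def tauSq (g : ℂ) (k K : Fin N → ℂ) (c : Matrix (Fin N) (Fin N) ℂ) (n : ℤ) (x : ℕ → ℂ) : ℂ :=
  (matA g k K c n x).det

/-- `∂₂² ln τₙ`, written as `∂₂ (∂₂(τₙ²) / (2 τₙ²))` so that no branch of the logarithm is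
involved. -/
def solQ (g : ℂ) (k K : Fin N → ℂ) (c : Matrix (Fin N) (Fin N) ℂ) (n : ℤ) : (ℕ → ℂ) → ℂ :=
  pd 2 (fun x => pd 2 (tauSq g k K c n) x / (2 * tauSq g k K c n x))

end EllKP

end

open scoped Matrix
open Filter Topology

namespace EllKP

/-- On the set `U`, the function `F'` is the partial derivative of `F` with respect to `xⱼ`. -/
def HasPd (U : Set (ℕ → ℂ)) (j : ℕ) (F F' : (ℕ → ℂ) → ℂ) : Prop :=
  ∀ y ∈ U, HasDerivAt (fun s : ℂ => F (Function.update y j s)) (F' y) (y j)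

/-- `U` is open along the direction of the time `xⱼ`. -/
def IsOpenAlong (U : Set (ℕ → ℂ)) (j : ℕ) : Prop :=
  ∀ y ∈ U, ∀ᶠ s in 𝓝 (y j), Function.update y j s ∈ U

namespace HasPd

variable {U : Set (ℕ → ℂ)} {i j : ℕ} {F G F' G' : (ℕ → ℂ) → ℂ}

theorem pd_eq (h : HasPd U j F F') {y : ℕ → ℂ} (hy : y ∈ U) : pd j F y = F' y :=
  (h y hy).deriv

theorem congr (h : HasPd U j F F') (hG : ∀ y ∈ U, F' y = G' y) : HasPd U j F G' :=
  fun y hy => hG y hy ▸ h y hy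

theorem congr_left (h : HasPd U j F F') (hU : IsOpenAlong U j) (hG : ∀ y ∈ U, G y = F y) :
    HasPd U j G F' := by
  intro y hy
  refine (h y hy).congr_of_eventuallyEq ?_
  filter_upwards [hU y hy] with s hs using hG _ hs

theorem pd (h : HasPd U i F G) (hG : HasPd U j G G') (hU : IsOpenAlong U j) :
    HasPd U j (pd i F) G' :=
  hG.congr_left hU fun _ hy => h.pd_eq hy

theorem const (a : ℂ) : HasPd U j (fun _ => a) (fun _ => 0) :=
  fun y _ => hasDerivAt_const (y j) a

theorem add (hF : HasPd U j F F') (hG : HasPd U j G G') :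
    HasPd U j (fun y => F y + G y) (fun y => F' y + G' y) :=
  fun y hy => (hF y hy).add (hG y hy)

theorem sub (hF : HasPd U j F F') (hG : HasPd U j G G') :
    HasPd U j (fun y => F y - G y) (fun y => F' y - G' y) :=
  fun y hy => (hF y hy).sub (hG y hy)

theorem neg (hF : HasPd U j F F') : HasPd U j (fun y => -F y) (fun y => -F' y) :=
  fun y hy => (hF y hy).neg

theorem mul (hF : HasPd U j F F') (hG : HasPd U j G G') :
    HasPd U j (fun y => F y * G y) (fun y => F' y * G y + F y * G' y) := by
  intro y hy
  have h := (hF y hy).mul (hG y hy)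
  rw [Function.update_eq_self] at h
  exact h

theorem const_mul (a : ℂ) (hF : HasPd U j F F') :
    HasPd U j (fun y => a * F y) (fun y => a * F' y) :=
  fun y hy => (hF y hy).const_mul a

end HasPd

section MatrixCalculus

variable {N : ℕ}

theorem analyticAt_det {E : Type*} [NormedAddCommGroup E] [NormedSpace ℂ E]
    {A : E → Matrix (Fin N) (Fin N) ℂ} {t : E} (hA : ∀ i j, AnalyticAt ℂ (fun s => A s i j) t) :
    AnalyticAt ℂ (fun s => (A s).det) t := by
  simp only [Matrix.det_apply]
  refine Finset.analyticAt_fun_sum _ fun σ _ => ?_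
  simp only [Units.smul_def, zsmul_eq_mul]
  exact analyticAt_const.mul (Finset.analyticAt_fun_prod _ fun i _ => hA _ _)

theorem analyticAt_inv_apply {E : Type*} [NormedAddCommGroup E] [NormedSpace ℂ E]
    {A : E → Matrix (Fin N) (Fin N) ℂ} {t : E} (hA : ∀ i j, AnalyticAt ℂ (fun s => A s i j) t)
    (hdet : (A t).det ≠ 0) (i j : Fin N) : AnalyticAt ℂ (fun s => (A s)⁻¹ i j) t := by
  simp only [Matrix.inv_def, Ring.inverse_eq_inv', Matrix.smul_apply, smul_eq_mul,
    Matrix.adjugate_apply]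
  refine ((analyticAt_det hA).inv hdet).mul (analyticAt_det fun a b => ?_)
  by_cases h : a = j
  · subst h
    simpa using analyticAt_const
  · simpa [Matrix.updateRow_ne h] using hA a b

theorem analyticAt_mul_apply {E : Type*} [NormedAddCommGroup E] [NormedSpace ℂ E]
    {A B : E → Matrix (Fin N) (Fin N) ℂ} {t : E} (hA : ∀ i j, AnalyticAt ℂ (fun s => A s i j) t)
    (hB : ∀ i j, AnalyticAt ℂ (fun s => B s i j) t) (i j : Fin N) :
    AnalyticAt ℂ (fun s => (A s * B s) i j) t := by
  simp only [Matrix.mul_apply]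
  exact Finset.analyticAt_fun_sum _ fun l _ => (hA i l).mul (hB l j)

/-- Entrywise derivative of a matrix valued function. -/
def HasMatrixDeriv (A : ℂ → Matrix (Fin N) (Fin N) ℂ) (A' : Matrix (Fin N) (Fin N) ℂ)
    (t : ℂ) : Prop :=
  ∀ i j, HasDerivAt (fun s => A s i j) (A' i j) t

namespace HasMatrixDeriv

variable {A B : ℂ → Matrix (Fin N) (Fin N) ℂ} {A' B' : Matrix (Fin N) (Fin N) ℂ} {t : ℂ}

theorem const (C : Matrix (Fin N) (Fin N) ℂ) : HasMatrixDeriv (fun _ => C) 0 t :=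
  fun _ _ => hasDerivAt_const _ _

theorem add (hA : HasMatrixDeriv A A' t) (hB : HasMatrixDeriv B B' t) :
    HasMatrixDeriv (fun s => A s + B s) (A' + B') t :=
  fun i j => (hA i j).add (hB i j)

theorem mul (hA : HasMatrixDeriv A A' t) (hB : HasMatrixDeriv B B' t) :
    HasMatrixDeriv (fun s => A s * B s) (A' * B t + A t * B') t := by
  intro i j
  simp only [Matrix.mul_apply, Matrix.add_apply, ← Finset.sum_add_distrib]
  exact HasDerivAt.fun_sum fun l _ => (hA i l).mul (hB l j)

theorem unique (hA : HasMatrixDeriv A A' t) (hB : HasMatrixDeriv A B' t) : A' = B' := by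
  ext i j
  exact (hA i j).unique (hB i j)

/-- Jacobi's formula. -/
theorem det (hA : HasMatrixDeriv A A' t) :
    HasDerivAt (fun s => (A s).det) ((A t).adjugate * A').trace t := by
  have key : ((A t).adjugate * A').trace = ∑ σ : Equiv.Perm (Fin N), ((Equiv.Perm.sign σ : ℤ) : ℂ) *
      ∑ i, (∏ j ∈ Finset.univ.erase i, A t (σ j) j) * A' (σ i) i := by
    have h1 : ∀ i, ((A t).adjugate * A') i i = ((A t).updateCol i (fun l => A' l i)).det := by
      intro i
      rw [← Matrix.cramer_apply, Matrix.cramer_eq_adjugate_mulVec]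
      rfl
    simp only [Matrix.trace, Matrix.diag_apply, h1, Matrix.det_apply, Units.smul_def, zsmul_eq_mul,
      Finset.mul_sum]
    rw [Finset.sum_comm]
    refine Finset.sum_congr rfl fun σ _ => Finset.sum_congr rfl fun i _ => ?_
    rw [← Finset.mul_prod_erase Finset.univ _ (Finset.mem_univ i), mul_comm (Finset.prod _ _),
      Matrix.updateCol_self]
    congr 2
    refine Finset.prod_congr rfl fun j hj => ?_
    rw [Matrix.updateCol_ne (Finset.ne_of_mem_erase hj)]
  rw [key]
  simp only [Matrix.det_apply, Units.smul_def, zsmul_eq_mul]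
  refine HasDerivAt.fun_sum fun σ _ => HasDerivAt.const_mul _ ?_
  simpa using HasDerivAt.fun_finsetProd (u := Finset.univ) (fun i _ => hA (σ i) i)

end HasMatrixDeriv

end MatrixCalculus

section Phase

variable {g k K : ℂ} {y : ℕ → ℂ}

theorem phase_update_of_odd (j : ℕ) (h : PhaseSummable g k K y) (t : ℂ) :
    PhaseSummable g k K (Function.update y (2 * j + 1) t) ∧
      phase g k K (Function.update y (2 * j + 1) t)
        = phase g k K y + k ^ (2 * j + 1) * (t - y (2 * j + 1)) := by
  have h1 : (fun i : ℕ => k ^ (2 * i + 1) * Function.update y (2 * j + 1) t (2 * i + 1))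
      = Function.update (fun i : ℕ => k ^ (2 * i + 1) * y (2 * i + 1)) j
        (k ^ (2 * j + 1) * t) := by
    ext i
    by_cases hi : i = j
    · subst hi; simp
    · rw [Function.update_of_ne hi, Function.update_of_ne (by omega)]
  have h2 : (fun i : ℕ => (K ^ (i + 1) - (g / K) ^ (i + 1)) *
      Function.update y (2 * j + 1) t (2 * (i + 1)))
      = fun i : ℕ => (K ^ (i + 1) - (g / K) ^ (i + 1)) * y (2 * (i + 1)) := by
    ext i
    rw [Function.update_of_ne (by omega)]
  have h3 := h.1.hasSum.update j (k ^ (2 * j + 1) * t)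
  rw [← h1] at h3
  refine ⟨⟨h3.summable, by rw [h2]; exact h.2⟩, ?_⟩
  rw [phase, phase, h3.tsum_eq, h2]
  ring

theorem phase_update_of_even (j : ℕ) (h : PhaseSummable g k K y) (t : ℂ) :
    PhaseSummable g k K (Function.update y (2 * (j + 1)) t) ∧
      phase g k K (Function.update y (2 * (j + 1)) t)
        = phase g k K y + (K ^ (j + 1) - (g / K) ^ (j + 1)) * (t - y (2 * (j + 1))) := by
  have h1 : (fun i : ℕ => (K ^ (i + 1) - (g / K) ^ (i + 1)) *
      Function.update y (2 * (j + 1)) t (2 * (i + 1)))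
      = Function.update (fun i : ℕ => (K ^ (i + 1) - (g / K) ^ (i + 1)) * y (2 * (i + 1))) j
        ((K ^ (j + 1) - (g / K) ^ (j + 1)) * t) := by
    ext i
    by_cases hi : i = j
    · subst hi; simp
    · rw [Function.update_of_ne hi, Function.update_of_ne (by omega)]
  have h2 : (fun i : ℕ => k ^ (2 * i + 1) * Function.update y (2 * (j + 1)) t (2 * i + 1))
      = fun i : ℕ => k ^ (2 * i + 1) * y (2 * i + 1) := by
    ext i
    rw [Function.update_of_ne (by omega)]
  have h3 := h.2.hasSum.update j ((K ^ (j + 1) - (g / K) ^ (j + 1)) * t)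
  rw [← h1] at h3
  refine ⟨⟨by rw [h2]; exact h.1, h3.summable⟩, ?_⟩
  rw [phase, phase, h3.tsum_eq, h2]
  ring

end Phase

end EllKP

namespace EllKP

/-- The exponent `phase` of the point `(k, K)` depends on the time `xⱼ` through the summand
`p * xⱼ` only. -/
def IsPhaseRate (g k K : ℂ) (j : ℕ) (p : ℂ) : Prop :=
  ∀ y, PhaseSummable g k K y → ∀ t, PhaseSummable g k K (Function.update y j t) ∧
    phase g k K (Function.update y j t) = phase g k K y + p * (t - y j)

theorem isPhaseRate_one (g k K : ℂ) : IsPhaseRate g k K 1 k := fun y h t => by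
  simpa using phase_update_of_odd 0 h t

theorem isPhaseRate_two (g k K : ℂ) : IsPhaseRate g k K 2 (K - g / K) := fun y h t => by
  simpa using phase_update_of_even 0 h t

theorem isPhaseRate_three (g k K : ℂ) : IsPhaseRate g k K 3 (k ^ 3) := fun y h t => by
  simpa using phase_update_of_odd 1 h t

variable {N : ℕ}

/-- The times at which all the series converge and `I + R M` is invertible. -/
def regularSet (g : ℂ) (k K : Fin N → ℂ) (c : Matrix (Fin N) (Fin N) ℂ) (n : ℤ) :
    Set (ℕ → ℂ) :=
  {y | (∀ ν, PhaseSummable g (k ν) (K ν) y) ∧ (matA g k K c n y).det ≠ 0}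

/-- The matrix `S = (I + R M)⁻¹ R`. -/
noncomputable def matS (g : ℂ) (k K : Fin N → ℂ) (c : Matrix (Fin N) (Fin N) ℂ) (n : ℤ)
    (x : ℕ → ℂ) : Matrix (Fin N) (Fin N) ℂ :=
  (matA g k K c n x)⁻¹ * matR g k K c n x

section Derivative

variable {g : ℂ} {k K : Fin N → ℂ} {c : Matrix (Fin N) (Fin N) ℂ} {n : ℤ} {j : ℕ}
  {p : Fin N → ℂ} {y : ℕ → ℂ}

theorem matR_update (hp : ∀ ν, IsPhaseRate g (k ν) (K ν) j (p ν))
    (hy : ∀ ν, PhaseSummable g (k ν) (K ν) y) (t : ℂ) (μ ν : Fin N) :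
    matR g k K c n (Function.update y j t) μ ν
      = Complex.exp ((p μ + p ν) * (t - y j)) * matR g k K c n y μ ν := by
  simp only [matR, Matrix.of_apply, (hp μ y (hy μ) t).2, (hp ν y (hy ν) t).2]
  rw [show phase g (k μ) (K μ) y + p μ * (t - y j) + (phase g (k ν) (K ν) y + p ν * (t - y j))
    = (p μ + p ν) * (t - y j) + (phase g (k μ) (K μ) y + phase g (k ν) (K ν) y) by ring,
    Complex.exp_add]
  ring

theorem analyticAt_matA {E : Type*} [NormedAddCommGroup E] [NormedSpace ℂ E]
    {f : E → ℕ → ℂ} {t : E}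
    (hf : ∀ μ ν, AnalyticAt ℂ (fun s => matR g k K c n (f s) μ ν) t) (μ ν : Fin N) :
    AnalyticAt ℂ (fun s => matA g k K c n (f s) μ ν) t := by
  simp only [matA, Matrix.add_apply]
  exact analyticAt_const.add (analyticAt_mul_apply (A := fun s => matR g k K c n (f s))
    (B := fun _ => matM g k K) hf (fun _ _ => analyticAt_const) μ ν)

theorem analyticAt_matS {E : Type*} [NormedAddCommGroup E] [NormedSpace ℂ E]
    {f : E → ℕ → ℂ} {t : E}
    (hf : ∀ μ ν, AnalyticAt ℂ (fun s => matR g k K c n (f s) μ ν) t)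
    (hdet : (matA g k K c n (f t)).det ≠ 0) (μ ν : Fin N) :
    AnalyticAt ℂ (fun s => matS g k K c n (f s) μ ν) t :=
  analyticAt_mul_apply (A := fun s => (matA g k K c n (f s))⁻¹)
    (analyticAt_inv_apply (analyticAt_matA hf) hdet) hf μ ν

theorem analyticAt_matR_update (hp : ∀ ν, IsPhaseRate g (k ν) (K ν) j (p ν))
    (hy : ∀ ν, PhaseSummable g (k ν) (K ν) y) (t : ℂ) (μ ν : Fin N) :
    AnalyticAt ℂ (fun s => matR g k K c n (Function.update y j s) μ ν) t := by
  simp only [matR_update hp hy]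
  exact ((analyticAt_const.mul (analyticAt_id.sub analyticAt_const)).cexp).mul analyticAt_const

theorem isOpenAlong_regularSet (hp : ∀ ν, IsPhaseRate g (k ν) (K ν) j (p ν)) :
    IsOpenAlong (regularSet g k K c n) j := by
  rintro y ⟨hy, hdet⟩
  have h := (analyticAt_det (analyticAt_matA (t := y j)
    (analyticAt_matR_update (c := c) (n := n) hp hy (y j)))).continuousAt
  have h' := h.eventually_ne (y := 0) (by simpa using hdet)
  filter_upwards [h'] with s hs using ⟨fun ν => (hp ν y (hy ν) s).1, hs⟩

theorem hasMatrixDeriv_matR (hp : ∀ ν, IsPhaseRate g (k ν) (K ν) j (p ν))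
    (hy : ∀ ν, PhaseSummable g (k ν) (K ν) y) :
    HasMatrixDeriv (fun s => matR g k K c n (Function.update y j s))
      (Matrix.diagonal p * matR g k K c n y + matR g k K c n y * Matrix.diagonal p) (y j) := by
  intro μ ν
  simp only [matR_update hp hy, Matrix.add_apply, Matrix.diagonal_mul, Matrix.mul_diagonal]
  have h : HasDerivAt (fun s : ℂ => (p μ + p ν) * (s - y j)) ((p μ + p ν) * 1) (y j) :=
    ((hasDerivAt_id (y j)).sub_const (y j)).const_mul _
  refine (h.cexp.mul_const (matR g k K c n y μ ν)).congr_deriv ?_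
  simp only [sub_self, mul_zero, Complex.exp_zero]
  ring

theorem matA_mul_matS (hdet : (matA g k K c n y).det ≠ 0) :
    matA g k K c n y * matS g k K c n y = matR g k K c n y := by
  rw [matS, Matrix.mul_nonsing_inv_cancel_left _ _ (Ne.isUnit hdet)]

theorem matA_inv_eq (hdet : (matA g k K c n y).det ≠ 0) :
    (matA g k K c n y)⁻¹ = 1 - matS g k K c n y * matM g k K := by
  have h : (matA g k K c n y)⁻¹ * matA g k K c n y = 1 :=
    Matrix.nonsing_inv_mul _ (Ne.isUnit hdet)
  rw [matA, mul_add, mul_one, ← mul_assoc, ← matA] at h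
  rw [matS, ← h, add_sub_cancel_right]

theorem matR_mul_eq (hdet : (matA g k K c n y).det ≠ 0) :
    matR g k K c n y * (1 - matM g k K * matS g k K c n y) = matS g k K c n y := by
  have h := matA_mul_matS hdet
  rw [matA, add_mul, one_mul, mul_assoc] at h
  rw [mul_sub, mul_one]
  nth_rw 1 [← h]
  abel

theorem hasMatrixDeriv_matS (hp : ∀ ν, IsPhaseRate g (k ν) (K ν) j (p ν))
    (hy : y ∈ regularSet g k K c n) :
    HasMatrixDeriv (fun s => matS g k K c n (Function.update y j s))
      (Matrix.diagonal p * matS g k K c n y + matS g k K c n y * Matrix.diagonal p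
        - matS g k K c n y * (Matrix.diagonal p * matM g k K + matM g k K * Matrix.diagonal p)
          * matS g k K c n y) (y j) := by
  obtain ⟨hy, hdet⟩ := hy
  have hR := hasMatrixDeriv_matR (c := c) (n := n) hp hy
  have hA : HasMatrixDeriv (fun s => matA g k K c n (Function.update y j s))
      (0 + (_ * matM g k K + _ * 0)) (y j) :=
    (HasMatrixDeriv.const 1).add (hR.mul (HasMatrixDeriv.const (matM g k K)))
  have hS : HasMatrixDeriv (fun s => matS g k K c n (Function.update y j s))
      (Matrix.of fun μ ν =>
        deriv (fun s => matS g k K c n (Function.update y j s) μ ν) (y j)) (y j) :=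
    fun μ ν => (analyticAt_matS (analyticAt_matR_update hp hy (y j))
      (by simpa using hdet) μ ν).differentiableAt.hasDerivAt
  set S' := Matrix.of fun μ ν =>
        deriv (fun s => matS g k K c n (Function.update y j s) μ ν) (y j)
  have hAS := hA.mul hS
  have hAR : HasMatrixDeriv (fun s => matA g k K c n (Function.update y j s)
      * matS g k K c n (Function.update y j s)) _ (y j) := fun μ ν =>
    (hR μ ν).congr_of_eventuallyEq <| by
      filter_upwards [isOpenAlong_regularSet hp y ⟨hy, hdet⟩] with s hs
      rw [matA_mul_matS hs.2]
  have h := hAS.unique hAR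
  rw [zero_add, mul_zero, add_zero, Function.update_eq_self] at h
  convert hS using 1
  have h1 := congrArg ((matA g k K c n y)⁻¹ * ·) h
  simp only [mul_add, Matrix.nonsing_inv_mul_cancel_left _ _ (Ne.isUnit hdet)] at h1
  have e1 : (matA g k K c n y)⁻¹ * matR g k K c n y = matS g k K c n y := rfl
  have e2 := matR_mul_eq hdet
  have e3 := matA_inv_eq hdet
  generalize Matrix.diagonal p = D at *
  generalize matS g k K c n y = S at *
  generalize matR g k K c n y = R at *
  generalize matM g k K = M at *
  generalize (matA g k K c n y)⁻¹ = B at *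
  have h2 : S' = B * D * (R * (1 - M * S)) + (B * R) * D * (1 - M * S) := by
    rw [← sub_eq_iff_eq_add'.mpr h1.symm]
    noncomm_ring
  rw [h2, e2, e1, e3]
  noncomm_ring

theorem hasDerivAt_tauSq (hp : ∀ ν, IsPhaseRate g (k ν) (K ν) j (p ν))
    (hy : y ∈ regularSet g k K c n) :
    HasDerivAt (fun s => tauSq g k K c n (Function.update y j s))
      (tauSq g k K c n y * (matS g k K c n y *
        (Matrix.diagonal p * matM g k K + matM g k K * Matrix.diagonal p)).trace) (y j) := by
  obtain ⟨hy, hdet⟩ := hy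
  have hR := hasMatrixDeriv_matR (c := c) (n := n) hp hy
  have hA : HasMatrixDeriv (fun s => matA g k K c n (Function.update y j s))
      (0 + (_ * matM g k K + _ * 0)) (y j) :=
    (HasMatrixDeriv.const 1).add (hR.mul (HasMatrixDeriv.const (matM g k K)))
  refine hA.det.congr_deriv (Eq.symm ?_)
  have h : (matA g k K c n y).adjugate = tauSq g k K c n y • (matA g k K c n y)⁻¹ := by
    rw [Matrix.inv_def, Ring.inverse_eq_inv', smul_smul, tauSq, mul_inv_cancel₀ hdet, one_smul]
  rw [zero_add, mul_zero, add_zero, Function.update_eq_self, h, Matrix.smul_mul,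
    Matrix.trace_smul, smul_eq_mul]
  congr 1
  have e1 : (matA g k K c n y)⁻¹ * matR g k K c n y = matS g k K c n y := rfl
  have e2 : matR g k K c n y * matM g k K * (matA g k K c n y)⁻¹
      = matS g k K c n y * matM g k K := by
    have h3 : matR g k K c n y * matM g k K = matA g k K c n y - 1 := by
      rw [matA, add_sub_cancel_left]
    rw [h3, sub_mul, Matrix.mul_nonsing_inv _ (Ne.isUnit hdet), one_mul, matA_inv_eq hdet,
      sub_sub_cancel]
  generalize Matrix.diagonal p = D
  have h1 : (matS g k K c n y * (D * matM g k K)).trace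
      = ((matA g k K c n y)⁻¹ * (matR g k K c n y * D * matM g k K)).trace := by
    rw [← e1]
    simp only [mul_assoc]
  have h2 : (matS g k K c n y * (matM g k K * D)).trace
      = ((matA g k K c n y)⁻¹ * (D * matR g k K c n y * matM g k K)).trace := by
    rw [← mul_assoc, ← e2, mul_assoc, Matrix.trace_mul_comm]
    simp only [mul_assoc]
  rw [add_mul, mul_add, mul_add, Matrix.trace_add, Matrix.trace_add, h1, h2, add_comm]

end Derivative

end EllKP

namespace EllKP

section Kernel

variable {e g k K k' K' : ℂ}

theorem eq_of_add_eq_zero (hK : K ≠ 0) (hK' : K' ≠ 0) (h : k ^ 2 = K + 3 * e + g / K)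
    (h' : k' ^ 2 = K' + 3 * e + g / K') (hadd : k + k' = 0) (hne : K * K' ≠ g) : K = K' := by
  have hk : k = -k' := eq_neg_of_add_eq_zero_left hadd
  have h1 : (K - K') * (K * K' - g) = 0 := by
    have h2 : K + 3 * e + g / K = K' + 3 * e + g / K' := by rw [← h, ← h', hk]; ring
    field_simp at h2
    linear_combination h2
  rcases mul_eq_zero.mp h1 with h3 | h3
  · exact sub_eq_zero.mp h3
  · exact absurd (sub_eq_zero.mp h3) hne

theorem add_mul_kernel (hK : K ≠ 0) (hK' : K' ≠ 0) (h : k ^ 2 = K + 3 * e + g / K)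
    (h' : k' ^ 2 = K' + 3 * e + g / K')
    (hne : k + k' ≠ 0 ∨ K * K' ≠ g ∨ (k = k' ∧ K = K')) :
    (k + k') * kernel g k K k' K' = K - K' := by
  unfold kernel
  split_ifs with h0
  · field_simp
  · have h0 := not_not.mp h0
    rw [h0, zero_mul, eq_comm, sub_eq_zero]
    rcases hne with hne | hne | hne
    · exact absurd h0 hne
    · exact eq_of_add_eq_zero hK hK' h h' h0 hne
    · exact hne.2

theorem kernel_mul (hK : K ≠ 0) (hK' : K' ≠ 0) (h : k ^ 2 = K + 3 * e + g / K)
    (h' : k' ^ 2 = K' + 3 * e + g / K')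
    (hne : k + k' ≠ 0 ∨ K * K' ≠ g ∨ (k = k' ∧ K = K')) :
    kernel g k K k' K' * (1 - g / (K * K')) = k - k' := by
  unfold kernel
  split_ifs with h0
  · have h1 : (K - K') * (1 - g / (K * K')) = (k - k') * (k + k') := by
      have h2 : (k - k') * (k + k') = (K + 3 * e + g / K) - (K' + 3 * e + g / K') := by
        rw [← h, ← h']; ring
      rw [h2]
      field_simp
      ring
    rw [div_mul_eq_mul_div, h1, mul_div_cancel_right₀ _ h0]
  · by_cases hkk : k = k'
    · simp [hkk]
    · have hg : K * K' ≠ g := by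
        rcases hne with hne | hne | hne
        · exact absurd (not_not.mp h0) (by simpa using hne)
        · exact hne
        · exact absurd hne.1 hkk
      have h1 : 1 - g / (K * K') ≠ 0 := by
        rw [sub_ne_zero, ne_comm, Ne, div_eq_one_iff_eq (mul_ne_zero hK hK')]
        exact hg.symm
      rw [div_mul_cancel₀ _ h1]

end Kernel

variable {N : ℕ}

/-- The vector with entries `k_ν ^ a * K_ν ^ b`. -/
noncomputable def mono (k K : Fin N → ℂ) (a : ℕ) (b : ℤ) : Fin N → ℂ := fun ν => k ν ^ a * K ν ^ b

/-- The bilinear form of the matrix `S = (I + R M)⁻¹ R` on vectors of monomials. -/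
noncomputable def pairing (g : ℂ) (k K : Fin N → ℂ) (c : Matrix (Fin N) (Fin N) ℂ) (n : ℤ)
    (a : ℕ) (b : ℤ) (a' : ℕ) (b' : ℤ) (x : ℕ → ℂ) : ℂ :=
  mono k K a b ⬝ᵥ matS g k K c n x *ᵥ mono k K a' b'

/-- The rules for differentiating the functions `pairing g k K c n a b a' b'`. -/
structure PairingRules (e g : ℂ) (U : Set (ℕ → ℂ))
    (s : ℕ → ℤ → ℕ → ℤ → (ℕ → ℂ) → ℂ) : Prop where
  skew : ∀ a b a' b', ∀ y ∈ U, s a b a' b' y = -s a' b' a b y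
  reduce : ∀ a b a' b', ∀ y ∈ U,
    s (a + 2) b a' b' y = s a (b + 1) a' b' y + 3 * e * s a b a' b' y + g * s a (b - 1) a' b' y
  open_one : IsOpenAlong U 1
  open_two : IsOpenAlong U 2
  open_three : IsOpenAlong U 3
  hasPd_one : ∀ a b a' b', HasPd U 1 (s a b a' b') fun y =>
    s (a + 1) b a' b' y + s a b (a' + 1) b' y
      - (s a b 0 1 y * s 0 0 a' b' y - s a b 0 0 y * s 0 1 a' b' y)
  hasPd_two : ∀ a b a' b', HasPd U 2 (s a b a' b') fun y =>
    (s a (b + 1) a' b' y - g * s a (b - 1) a' b' y)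
      + (s a b a' (b' + 1) y - g * s a b a' (b' - 1) y)
      - (s a b 1 1 y * s 0 0 a' b' y - s a b 0 1 y * s 1 0 a' b' y
        + s a b 1 0 y * s 0 1 a' b' y - s a b 0 0 y * s 1 1 a' b' y)
  hasPd_three : ∀ a b a' b', HasPd U 3 (s a b a' b') fun y =>
    s (a + 3) b a' b' y + s a b (a' + 3) b' y
      - (s a b 2 1 y * s 0 0 a' b' y - s a b 2 0 y * s 0 1 a' b' y - s a b 1 1 y * s 1 0 a' b' y
        + s a b 1 0 y * s 1 1 a' b' y + s a b 0 1 y * s 2 0 a' b' y - s a b 0 0 y * s 2 1 a' b' y)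

section Pairing

variable {e g : ℂ} {k K : Fin N → ℂ} {c : Matrix (Fin N) (Fin N) ℂ} {n : ℤ} {j : ℕ}
  {p : Fin N → ℂ} {y : ℕ → ℂ}

theorem dotProduct_rankOne (S : Matrix (Fin N) (Fin N) ℂ) (a b f h : Fin N → ℂ) :
    a ⬝ᵥ (S * Matrix.vecMulVec f h * S) *ᵥ b = (a ⬝ᵥ S *ᵥ f) * (h ⬝ᵥ S *ᵥ b) := by
  rw [mul_assoc, ← Matrix.mulVec_mulVec, ← Matrix.mulVec_mulVec, Matrix.vecMulVec_mulVec]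
  simp [Matrix.mulVec_smul, mul_comm]

theorem hasPd_dotProduct (hp : ∀ ν, IsPhaseRate g (k ν) (K ν) j (p ν)) (a b : Fin N → ℂ) :
    HasPd (regularSet g k K c n) j (fun y => a ⬝ᵥ matS g k K c n y *ᵥ b) fun y =>
      (p * a) ⬝ᵥ matS g k K c n y *ᵥ b + a ⬝ᵥ matS g k K c n y *ᵥ (p * b)
        - a ⬝ᵥ (matS g k K c n y *
          (Matrix.diagonal p * matM g k K + matM g k K * Matrix.diagonal p)
          * matS g k K c n y) *ᵥ b := by
  intro y hy
  have hS := hasMatrixDeriv_matS hp hy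
  have h : HasDerivAt (fun s => a ⬝ᵥ matS g k K c n (Function.update y j s) *ᵥ b) _ (y j) :=
    HasDerivAt.fun_sum fun μ _ => (HasDerivAt.fun_sum fun ν _ =>
      (hS μ ν).mul_const (b ν)).const_mul (a μ)
  refine h.congr_deriv ?_
  beta_reduce
  generalize matS g k K c n y = S
  generalize Matrix.diagonal p * matM g k K + matM g k K * Matrix.diagonal p = W
  change a ⬝ᵥ (Matrix.diagonal p * S + S * Matrix.diagonal p - S * W * S) *ᵥ b = _
  rw [Matrix.sub_mulVec, Matrix.add_mulVec, dotProduct_sub, dotProduct_add]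
  congr 2
  · rw [← Matrix.mulVec_mulVec]
    simp only [dotProduct, Matrix.mulVec_diagonal, Pi.mul_apply]
    exact Finset.sum_congr rfl fun _ _ => by ring
  · rw [← Matrix.mulVec_mulVec]
    congr 2
    ext ν
    simp [Matrix.mulVec_diagonal]

theorem matM_transpose : (matM g k K)ᵀ = -matM g k K := by
  ext μ ν
  simp only [Matrix.transpose_apply, Matrix.neg_apply, matM, Matrix.of_apply, kernel]
  rw [add_comm (k ν), mul_comm (K ν)]
  split_ifs <;> ring

theorem matR_transpose (hc : ∀ μ ν, c μ ν = -c ν μ) (y : ℕ → ℂ) :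
    (matR g k K c n y)ᵀ = -matR g k K c n y := by
  ext μ ν
  simp only [Matrix.transpose_apply, Matrix.neg_apply, matR, Matrix.of_apply]
  rw [hc μ ν, add_comm (phase g (k ν) (K ν) y), mul_comm (K ν)]
  ring

theorem matS_transpose (hc : ∀ μ ν, c μ ν = -c ν μ) (hdet : (matA g k K c n y).det ≠ 0) :
    (matS g k K c n y)ᵀ = -matS g k K c n y := by
  have hA : (matA g k K c n y)ᵀ = 1 + matM g k K * matR g k K c n y := by
    rw [matA, Matrix.transpose_add, Matrix.transpose_mul, matM_transpose, matR_transpose hc,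
      Matrix.transpose_one, neg_mul_neg]
  have h : matA g k K c n y * matR g k K c n y
      = matR g k K c n y * (matA g k K c n y)ᵀ := by
    rw [hA, matA]
    noncomm_ring
  have hdet' : IsUnit ((matA g k K c n y)ᵀ).det := by
    rw [Matrix.det_transpose]
    exact hdet.isUnit
  rw [matS, Matrix.transpose_mul, matR_transpose hc, Matrix.transpose_nonsing_inv, neg_mul]
  congr 1
  rw [← Matrix.nonsing_inv_mul_cancel_left (A := matA g k K c n y)
    (matR g k K c n y * ((matA g k K c n y)ᵀ)⁻¹) hdet.isUnit, ← mul_assoc (matA g k K c n y), h,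
    Matrix.mul_nonsing_inv_cancel_right _ _ hdet']

theorem pairing_skew (hc : ∀ μ ν, c μ ν = -c ν μ) (hdet : (matA g k K c n y).det ≠ 0)
    (a : ℕ) (b : ℤ) (a' : ℕ) (b' : ℤ) :
    pairing g k K c n a b a' b' y = -pairing g k K c n a' b' a b y := by
  rw [pairing, pairing, Matrix.dotProduct_mulVec, ← Matrix.mulVec_transpose,
    matS_transpose hc hdet, Matrix.neg_mulVec, neg_dotProduct, dotProduct_comm]

theorem mono_succ (a : ℕ) (b : ℤ) : k * mono k K a b = mono k K (a + 1) b := by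
  ext ν
  simp only [mono, Pi.mul_apply]
  ring

theorem cube_mul_mono (a : ℕ) (b : ℤ) :
    (fun ν => k ν ^ 3) * mono k K a b = mono k K (a + 3) b := by
  ext ν
  simp only [mono, Pi.mul_apply]
  ring

theorem sub_div_mul_mono (hK : ∀ ν, K ν ≠ 0) (a : ℕ) (b : ℤ) :
    (fun ν => K ν - g / K ν) * mono k K a b = mono k K a (b + 1) - g • mono k K a (b - 1) := by
  ext ν
  simp only [mono, Pi.mul_apply, Pi.sub_apply, Pi.smul_apply, smul_eq_mul,
    zpow_add_one₀ (hK ν), zpow_sub_one₀ (hK ν)]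
  ring

theorem mono_add_two (hK : ∀ ν, K ν ≠ 0) (hcurve : ∀ ν, k ν ^ 2 = K ν + 3 * e + g / K ν)
    (a : ℕ) (b : ℤ) :
    mono k K (a + 2) b
      = mono k K a (b + 1) + (3 * e) • mono k K a b + g • mono k K a (b - 1) := by
  ext ν
  simp only [mono, Pi.add_apply, Pi.smul_apply, smul_eq_mul, zpow_add_one₀ (hK ν),
    zpow_sub_one₀ (hK ν), pow_add, hcurve ν]
  ring

theorem anticomm_one (h : ∀ μ ν, (k μ + k ν) * matM g k K μ ν = K μ - K ν) :
    Matrix.diagonal k * matM g k K + matM g k K * Matrix.diagonal k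
      = Matrix.vecMulVec (mono k K 0 1) (mono k K 0 0)
        - Matrix.vecMulVec (mono k K 0 0) (mono k K 0 1) := by
  ext μ ν
  simp only [Matrix.add_apply, Matrix.sub_apply, Matrix.diagonal_mul, Matrix.mul_diagonal,
    Matrix.vecMulVec_apply, mono, pow_zero, zpow_zero, zpow_one]
  linear_combination h μ ν

theorem anticomm_two (hK : ∀ ν, K ν ≠ 0)
    (h : ∀ μ ν, matM g k K μ ν * (1 - g / (K μ * K ν)) = k μ - k ν) :
    Matrix.diagonal (fun ν => K ν - g / K ν) * matM g k K
        + matM g k K * Matrix.diagonal (fun ν => K ν - g / K ν)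
      = Matrix.vecMulVec (mono k K 1 1) (mono k K 0 0)
        - Matrix.vecMulVec (mono k K 0 1) (mono k K 1 0)
        + Matrix.vecMulVec (mono k K 1 0) (mono k K 0 1)
        - Matrix.vecMulVec (mono k K 0 0) (mono k K 1 1) := by
  ext μ ν
  simp only [Matrix.add_apply, Matrix.sub_apply, Matrix.diagonal_mul, Matrix.mul_diagonal,
    Matrix.vecMulVec_apply, mono, pow_zero, zpow_zero, zpow_one, pow_one]
  have h1 : K μ - g / K μ + (K ν - g / K ν) = (K μ + K ν) * (1 - g / (K μ * K ν)) := by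
    have := hK μ
    have := hK ν
    field_simp
    ring
  linear_combination (K μ + K ν) * h μ ν + matM g k K μ ν * h1

theorem anticomm_three (h : ∀ μ ν, (k μ + k ν) * matM g k K μ ν = K μ - K ν) :
    Matrix.diagonal (fun ν => k ν ^ 3) * matM g k K
        + matM g k K * Matrix.diagonal (fun ν => k ν ^ 3)
      = Matrix.vecMulVec (mono k K 2 1) (mono k K 0 0)
        - Matrix.vecMulVec (mono k K 2 0) (mono k K 0 1)
        - Matrix.vecMulVec (mono k K 1 1) (mono k K 1 0)
        + Matrix.vecMulVec (mono k K 1 0) (mono k K 1 1)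
        + Matrix.vecMulVec (mono k K 0 1) (mono k K 2 0)
        - Matrix.vecMulVec (mono k K 0 0) (mono k K 2 1) := by
  ext μ ν
  simp only [Matrix.add_apply, Matrix.sub_apply, Matrix.diagonal_mul, Matrix.mul_diagonal,
    Matrix.vecMulVec_apply, mono, pow_zero, zpow_zero, zpow_one, pow_one]
  linear_combination (k μ ^ 2 - k μ * k ν + k ν ^ 2) * h μ ν

theorem pairingRules (hK : ∀ ν, K ν ≠ 0) (hcurve : ∀ ν, k ν ^ 2 = K ν + 3 * e + g / K ν)
    (hkernel : ∀ μ ν, μ ≠ ν → k μ + k ν ≠ 0 ∨ K μ * K ν ≠ g) (hc : ∀ μ ν, c μ ν = -c ν μ) :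
    PairingRules e g (regularSet g k K c n) (pairing g k K c n) := by
  have hne : ∀ μ ν, k μ + k ν ≠ 0 ∨ K μ * K ν ≠ g ∨ (k μ = k ν ∧ K μ = K ν) := by
    intro μ ν
    by_cases h : μ = ν
    · exact Or.inr (Or.inr (by simp [h]))
    · exact (hkernel μ ν h).imp_right Or.inl
  have h1 := anticomm_one (g := g) (k := k) (K := K) fun μ ν =>
    add_mul_kernel (hK μ) (hK ν) (hcurve μ) (hcurve ν) (hne μ ν)
  have h2 := anticomm_two hK fun μ ν =>
    kernel_mul (hK μ) (hK ν) (hcurve μ) (hcurve ν) (hne μ ν)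
  have h3 := anticomm_three (g := g) (k := k) (K := K) fun μ ν =>
    add_mul_kernel (hK μ) (hK ν) (hcurve μ) (hcurve ν) (hne μ ν)
  have r1 : ∀ ν, IsPhaseRate g (k ν) (K ν) 1 (k ν) := fun ν => isPhaseRate_one _ _ _
  have r2 : ∀ ν, IsPhaseRate g (k ν) (K ν) 2 (K ν - g / K ν) := fun ν => isPhaseRate_two _ _ _
  have r3 : ∀ ν, IsPhaseRate g (k ν) (K ν) 3 (k ν ^ 3) := fun ν => isPhaseRate_three _ _ _
  refine ⟨fun a b a' b' y hy => pairing_skew hc hy.2 a b a' b', fun a b a' b' y _ => ?_,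
    isOpenAlong_regularSet r1, isOpenAlong_regularSet r2, isOpenAlong_regularSet r3,
    fun a b a' b' => (hasPd_dotProduct r1 _ _).congr fun y _ => ?_,
    fun a b a' b' => (hasPd_dotProduct r2 _ _).congr fun y _ => ?_,
    fun a b a' b' => (hasPd_dotProduct r3 _ _).congr fun y _ => ?_⟩
  · simp only [pairing, mono_add_two hK hcurve, add_dotProduct, smul_dotProduct, smul_eq_mul]
  · simp only [h1, mul_sub, sub_mul, Matrix.sub_mulVec, dotProduct_sub, dotProduct_rankOne,
      mono_succ, pairing]
  · simp only [h2, mul_sub, sub_mul, mul_add, add_mul, Matrix.sub_mulVec, Matrix.add_mulVec,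
      dotProduct_sub, dotProduct_add, dotProduct_rankOne, sub_div_mul_mono hK, pairing,
      sub_dotProduct, smul_dotProduct, Matrix.mulVec_sub, Matrix.mulVec_smul, dotProduct_smul,
      smul_eq_mul]
  · simp only [h3, mul_sub, sub_mul, mul_add, add_mul, Matrix.sub_mulVec, Matrix.add_mulVec,
      dotProduct_sub, dotProduct_add, dotProduct_rankOne, cube_mul_mono, pairing]

/-- The derivative of `τ²` with respect to `x₂`. -/
theorem hasPd_tauSq_two (hK : ∀ ν, K ν ≠ 0)
    (hcurve : ∀ ν, k ν ^ 2 = K ν + 3 * e + g / K ν)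
    (hkernel : ∀ μ ν, μ ≠ ν → k μ + k ν ≠ 0 ∨ K μ * K ν ≠ g) (hc : ∀ μ ν, c μ ν = -c ν μ) :
    HasPd (regularSet g k K c n) 2 (tauSq g k K c n) fun y =>
      2 * tauSq g k K c n y * (pairing g k K c n 0 1 1 0 y - pairing g k K c n 1 1 0 0 y) := by
  have hne : ∀ μ ν, k μ + k ν ≠ 0 ∨ K μ * K ν ≠ g ∨ (k μ = k ν ∧ K μ = K ν) := by
    intro μ ν
    by_cases h : μ = ν
    · exact Or.inr (Or.inr (by simp [h]))
    · exact (hkernel μ ν h).imp_right Or.inl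
  have h2 := anticomm_two hK fun μ ν =>
    kernel_mul (hK μ) (hK ν) (hcurve μ) (hcurve ν) (hne μ ν)
  intro y hy
  refine (hasDerivAt_tauSq (fun ν => isPhaseRate_two g (k ν) (K ν)) hy).congr_deriv ?_
  have ht : ∀ f h : Fin N → ℂ, (matS g k K c n y * Matrix.vecMulVec f h).trace
      = h ⬝ᵥ matS g k K c n y *ᵥ f := fun f h => by
    rw [Matrix.mul_vecMulVec, Matrix.trace_vecMulVec, dotProduct_comm]
  have e1 := pairing_skew hc hy.2 0 0 1 1
  have e2 := pairing_skew hc hy.2 1 0 0 1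
  simp only [h2, mul_sub, mul_add, Matrix.trace_sub, Matrix.trace_add, ht]
  simp only [pairing] at *
  linear_combination tauSq g k K c n y * (e1 - e2)

end Pairing

end EllKP

namespace EllKP

set_option linter.unusedSimpArgs false

namespace PairingRules

variable {e g : ℂ} {U : Set (ℕ → ℂ)} {s : ℕ → ℤ → ℕ → ℤ → (ℕ → ℂ) → ℂ} {y : ℕ → ℂ}

theorem reduce_two (hs : PairingRules e g U s) (hy : y ∈ U) (b : ℤ) (a' : ℕ) (b' : ℤ) :
    s 2 b a' b' y
      = s 0 (b + 1) a' b' y + 3 * e * s 0 b a' b' y + g * s 0 (b - 1) a' b' y :=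
  hs.reduce 0 b a' b' y hy

theorem reduce_three (hs : PairingRules e g U s) (hy : y ∈ U) (b : ℤ) (a' : ℕ) (b' : ℤ) :
    s 3 b a' b' y
      = s 1 (b + 1) a' b' y + 3 * e * s 1 b a' b' y + g * s 1 (b - 1) a' b' y :=
  hs.reduce 1 b a' b' y hy

theorem reduce_two_right (hs : PairingRules e g U s) (hy : y ∈ U) (a : ℕ) (b b' : ℤ) :
    s a b 2 b' y = s a b 0 (b' + 1) y + 3 * e * s a b 0 b' y + g * s a b 0 (b' - 1) y := by
  rw [hs.skew a b 2 b' y hy, hs.skew a b 0 _ y hy, hs.skew a b 0 b' y hy, hs.skew a b 0 _ y hy,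
    hs.reduce_two hy]
  ring

theorem reduce_three_right (hs : PairingRules e g U s) (hy : y ∈ U) (a : ℕ) (b b' : ℤ) :
    s a b 3 b' y = s a b 1 (b' + 1) y + 3 * e * s a b 1 b' y + g * s a b 1 (b' - 1) y := by
  rw [hs.skew a b 3 b' y hy, hs.skew a b 1 _ y hy, hs.skew a b 1 b' y hy, hs.skew a b 1 _ y hy,
    hs.reduce_three hy]
  ring

theorem reduce_four_right (hs : PairingRules e g U s) (hy : y ∈ U) (a : ℕ) (b b' : ℤ) :
    s a b 4 b' y = s a b 2 (b' + 1) y + 3 * e * s a b 2 b' y + g * s a b 2 (b' - 1) y := by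
  rw [hs.skew a b 4 b' y hy, hs.skew a b 2 _ y hy, hs.skew a b 2 b' y hy, hs.skew a b 2 _ y hy,
    hs.reduce 2 b' a b y hy]
  ring

theorem skew_one_zero (hs : PairingRules e g U s) (hy : y ∈ U) (b b' : ℤ) :
    s 1 b 0 b' y = -s 0 b' 1 b y :=
  hs.skew 1 b 0 b' y hy

theorem skew_of_lt (hs : PairingRules e g U s) (hy : y ∈ U) (a : ℕ) {b b' : ℤ} (_h : b' < b) :
    s a b a b' y = -s a b' a b y :=
  hs.skew a b a b' y hy

theorem skew_self (hs : PairingRules e g U s) (hy : y ∈ U) (a : ℕ) (b : ℤ) : s a b a b y = 0 :=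
  self_eq_neg.mp (hs.skew a b a b y hy)

/-! ### Derivatives of `u = s 0 0 0 1`, `∂₂ ln τ = s 0 1 1 0 + s 0 0 1 1`, `g (v - 1) = s 0 1 1 1`
and `1 - w = s 0 0 1 0` -/

theorem hasPd_one_u (hs : PairingRules e g U s) :
    HasPd U 1 (fun y => s 0 0 0 1 y)
      fun y => s 0 0 1 1 y - s 0 1 1 0 y - s 0 0 0 1 y * s 0 0 0 1 y := by
  refine (hs.hasPd_one 0 0 0 1).congr fun y hy => ?_
  simp only [hs.reduce_two hy, hs.reduce_three hy, hs.reduce_two_right hy,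
    hs.reduce_three_right hy, hs.reduce_four_right hy, hs.skew_one_zero hy, hs.skew_of_lt hy,
    hs.skew_self hy, Nat.reduceAdd, Int.reduceAdd, Int.reduceSub, Int.reduceNeg, Int.reduceLT]
  ring

theorem hasPd_one_one_u (hs : PairingRules e g U s) :
    HasPd U 1 (fun y => s 0 0 1 1 y - s 0 1 1 0 y - s 0 0 0 1 y * s 0 0 0 1 y)
      fun y => (6 * e) * s 0 0 0 1 y + g * s 0 (-1) 0 1 y
        + 2 * (s 0 0 0 1 y * s 0 0 0 1 y * s 0 0 0 1 y) - 3 * (s 0 0 0 1 y * s 0 0 1 1 y)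
        + 3 * (s 0 0 0 1 y * s 0 1 1 0 y) + s 0 0 0 2 y + 2 * s 1 0 1 1 y := by
  refine (((hs.hasPd_one 0 0 1 1).sub
      (hs.hasPd_one 0 1 1 0)).sub
      ((hs.hasPd_one 0 0 0 1).mul (hs.hasPd_one 0 0 0 1))).congr fun y hy => ?_
  simp only [hs.reduce_two hy, hs.reduce_three hy, hs.reduce_two_right hy,
    hs.reduce_three_right hy, hs.reduce_four_right hy, hs.skew_one_zero hy, hs.skew_of_lt hy,
    hs.skew_self hy, Nat.reduceAdd, Int.reduceAdd, Int.reduceSub, Int.reduceNeg, Int.reduceLT]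
  ring

theorem hasPd_two_u (hs : PairingRules e g U s) :
    HasPd U 2 (fun y => s 0 0 0 1 y)
      fun y => s 0 0 0 2 y - g * s 0 (-1) 0 1 y - s 0 0 0 1 y * s 0 0 1 1 y
        - s 0 0 0 1 y * s 0 1 1 0 y := by
  refine (hs.hasPd_two 0 0 0 1).congr fun y hy => ?_
  simp only [hs.reduce_two hy, hs.reduce_three hy, hs.reduce_two_right hy,
    hs.reduce_three_right hy, hs.reduce_four_right hy, hs.skew_one_zero hy, hs.skew_of_lt hy,
    hs.skew_self hy, Nat.reduceAdd, Int.reduceAdd, Int.reduceSub, Int.reduceNeg, Int.reduceLT]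
  ring

theorem hasPd_two_logTau (hs : PairingRules e g U s) :
    HasPd U 2 (fun y => s 0 1 1 0 y + s 0 0 1 1 y)
      fun y => 2 * (s 0 0 0 1 y * s 1 0 1 1 y) - g * s 0 (-1) 1 1 y
        - (2 * g) * s 0 0 1 0 y - g * s 0 1 1 (-1) y - 2 * (s 0 0 1 0 y * s 0 1 1 1 y)
        - s 0 0 1 1 y * s 0 0 1 1 y + s 0 0 1 2 y - s 0 1 1 0 y * s 0 1 1 0 y + 2 * s 0 1 1 1 y
        + s 0 2 1 0 y := by
  refine ((hs.hasPd_two 0 1 1 0).add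
      (hs.hasPd_two 0 0 1 1)).congr fun y hy => ?_
  simp only [hs.reduce_two hy, hs.reduce_three hy, hs.reduce_two_right hy,
    hs.reduce_three_right hy, hs.reduce_four_right hy, hs.skew_one_zero hy, hs.skew_of_lt hy,
    hs.skew_self hy, Nat.reduceAdd, Int.reduceAdd, Int.reduceSub, Int.reduceNeg, Int.reduceLT]
  ring

theorem hasPd_one_v (hs : PairingRules e g U s) :
    HasPd U 1 (fun y => s 0 1 1 1 y)
      fun y => s 0 1 0 2 y - g * s 0 0 0 1 y - s 0 0 0 1 y * s 0 1 1 1 y := by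
  refine (hs.hasPd_one 0 1 1 1).congr fun y hy => ?_
  simp only [hs.reduce_two hy, hs.reduce_three hy, hs.reduce_two_right hy,
    hs.reduce_three_right hy, hs.reduce_four_right hy, hs.skew_one_zero hy, hs.skew_of_lt hy,
    hs.skew_self hy, Nat.reduceAdd, Int.reduceAdd, Int.reduceSub, Int.reduceNeg, Int.reduceLT]
  ring

theorem hasPd_one_one_v (hs : PairingRules e g U s) :
    HasPd U 1 (fun y => s 0 1 0 2 y - g * s 0 0 0 1 y - s 0 0 0 1 y * s 0 1 1 1 y)
      fun y => (2 * g) * (s 0 0 0 1 y * s 0 0 0 1 y) - g * s 0 0 1 1 y + g * s 0 1 1 0 y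
        + 2 * (s 0 0 0 1 y * s 0 0 0 1 y * s 0 1 1 1 y) - 2 * (s 0 0 0 1 y * s 0 1 0 2 y)
        - s 0 0 1 1 y * s 0 1 1 1 y + s 0 1 1 0 y * s 0 1 1 1 y + s 0 1 1 2 y - s 0 2 1 1 y := by
  refine (((hs.hasPd_one 0 1 0 2).sub
      ((hs.hasPd_one 0 0 0 1).const_mul g)).sub
      ((hs.hasPd_one 0 0 0 1).mul (hs.hasPd_one 0 1 1 1))).congr fun y hy => ?_
  simp only [hs.reduce_two hy, hs.reduce_three hy, hs.reduce_two_right hy,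
    hs.reduce_three_right hy, hs.reduce_four_right hy, hs.skew_one_zero hy, hs.skew_of_lt hy,
    hs.skew_self hy, Nat.reduceAdd, Int.reduceAdd, Int.reduceSub, Int.reduceNeg, Int.reduceLT]
  ring

theorem hasPd_two_v (hs : PairingRules e g U s) :
    HasPd U 2 (fun y => s 0 1 1 1 y)
      fun y => s 0 1 1 2 y + s 0 2 1 1 y - g * s 0 0 1 1 y - g * s 0 1 1 0 y
        - s 0 0 1 1 y * s 0 1 1 1 y - s 0 1 1 0 y * s 0 1 1 1 y := by
  refine (hs.hasPd_two 0 1 1 1).congr fun y hy => ?_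
  simp only [hs.reduce_two hy, hs.reduce_three hy, hs.reduce_two_right hy,
    hs.reduce_three_right hy, hs.reduce_four_right hy, hs.skew_one_zero hy, hs.skew_of_lt hy,
    hs.skew_self hy, Nat.reduceAdd, Int.reduceAdd, Int.reduceSub, Int.reduceNeg, Int.reduceLT]
  ring

theorem hasPd_one_w (hs : PairingRules e g U s) :
    HasPd U 1 (fun y => s 0 0 1 0 y)
      fun y => s 0 0 0 1 y - g * s 0 (-1) 0 0 y - s 0 0 0 1 y * s 0 0 1 0 y := by
  refine (hs.hasPd_one 0 0 1 0).congr fun y hy => ?_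
  simp only [hs.reduce_two hy, hs.reduce_three hy, hs.reduce_two_right hy,
    hs.reduce_three_right hy, hs.reduce_four_right hy, hs.skew_one_zero hy, hs.skew_of_lt hy,
    hs.skew_self hy, Nat.reduceAdd, Int.reduceAdd, Int.reduceSub, Int.reduceNeg, Int.reduceLT]
  ring

theorem hasPd_one_one_w (hs : PairingRules e g U s) :
    HasPd U 1 (fun y => s 0 0 0 1 y - g * s 0 (-1) 0 0 y - s 0 0 0 1 y * s 0 0 1 0 y)
      fun y => (2 * g) * (s 0 (-1) 0 0 y * s 0 0 0 1 y) - g * s 0 (-1) 1 0 y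
        + g * s 0 0 1 (-1) y - 2 * (s 0 0 0 1 y * s 0 0 0 1 y)
        + 2 * (s 0 0 0 1 y * s 0 0 0 1 y * s 0 0 1 0 y) - s 0 0 1 0 y * s 0 0 1 1 y
        + s 0 0 1 0 y * s 0 1 1 0 y + s 0 0 1 1 y - s 0 1 1 0 y := by
  refine (((hs.hasPd_one 0 0 0 1).sub
      ((hs.hasPd_one 0 (-1) 0 0).const_mul g)).sub
      ((hs.hasPd_one 0 0 0 1).mul (hs.hasPd_one 0 0 1 0))).congr fun y hy => ?_
  simp only [hs.reduce_two hy, hs.reduce_three hy, hs.reduce_two_right hy,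
    hs.reduce_three_right hy, hs.reduce_four_right hy, hs.skew_one_zero hy, hs.skew_of_lt hy,
    hs.skew_self hy, Nat.reduceAdd, Int.reduceAdd, Int.reduceSub, Int.reduceNeg, Int.reduceLT]
  ring

theorem hasPd_two_w (hs : PairingRules e g U s) :
    HasPd U 2 (fun y => s 0 0 1 0 y)
      fun y => s 0 0 1 1 y + s 0 1 1 0 y - g * s 0 (-1) 1 0 y - g * s 0 0 1 (-1) y
        - s 0 0 1 0 y * s 0 0 1 1 y - s 0 0 1 0 y * s 0 1 1 0 y := by
  refine (hs.hasPd_two 0 0 1 0).congr fun y hy => ?_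
  simp only [hs.reduce_two hy, hs.reduce_three hy, hs.reduce_two_right hy,
    hs.reduce_three_right hy, hs.reduce_four_right hy, hs.skew_one_zero hy, hs.skew_of_lt hy,
    hs.skew_self hy, Nat.reduceAdd, Int.reduceAdd, Int.reduceSub, Int.reduceNeg, Int.reduceLT]
  ring

theorem solvesAt (hs : PairingRules e g U s) (hg : g ≠ 0) {u v w q : (ℕ → ℂ) → ℂ} {x : ℕ → ℂ}
    (hx : x ∈ U) (hau : AnalyticAtTimes u x) (hav : AnalyticAtTimes v x)
    (haw : AnalyticAtTimes w x) (haq : AnalyticAtTimes q x)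
    (hu : ∀ y ∈ U, u y = s 0 0 0 1 y) (hv : ∀ y ∈ U, v y = 1 + g⁻¹ * s 0 1 1 1 y)
    (hw : ∀ y ∈ U, w y = 1 - s 0 0 1 0 y)
    (hq : ∀ y ∈ U, q y = 2 * (s 0 0 0 1 y * s 1 0 1 1 y) - g * s 0 (-1) 1 1 y
        - (2 * g) * s 0 0 1 0 y - g * s 0 1 1 (-1) y - 2 * (s 0 0 1 0 y * s 0 1 1 1 y)
        - s 0 0 1 1 y * s 0 0 1 1 y + s 0 0 1 2 y - s 0 1 1 0 y * s 0 1 1 0 y + 2 * s 0 1 1 1 y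
        + s 0 2 1 0 y) :
    SolvesAt e g u v w q x := by
  have o1 := hs.open_one
  have o2 := hs.open_two
  have o3 := hs.open_three
  have hg1 : g⁻¹ * g = 1 := inv_mul_cancel₀ hg
  have hu1 := hs.hasPd_one_u.congr_left o1 hu
  have hu11 := hu1.pd hs.hasPd_one_one_u o1
  have hu111 := hu11.pd
    ((((((((hs.hasPd_one 0 0 0 1).const_mul (6 * e)).add
      ((hs.hasPd_one 0 (-1) 0 1).const_mul g)).add
      ((((hs.hasPd_one 0 0 0 1).mul (hs.hasPd_one 0 0 0 1)).mul (hs.hasPd_one 0 0 0 1)).const_mul 2)).sub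
      (((hs.hasPd_one 0 0 0 1).mul (hs.hasPd_one 0 0 1 1)).const_mul 3)).add
      (((hs.hasPd_one 0 0 0 1).mul (hs.hasPd_one 0 1 1 0)).const_mul 3)).add
      (hs.hasPd_one 0 0 0 2)).add
      ((hs.hasPd_one 1 0 1 1).const_mul 2)) o1
  have hu2 := hs.hasPd_two_u.congr_left o2 hu
  have hu22 := hu2.pd
    ((((hs.hasPd_two 0 0 0 2).sub
      ((hs.hasPd_two 0 (-1) 0 1).const_mul g)).sub
      ((hs.hasPd_two 0 0 0 1).mul (hs.hasPd_two 0 0 1 1))).sub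
      ((hs.hasPd_two 0 0 0 1).mul (hs.hasPd_two 0 1 1 0))) o2
  have hu3 := (hs.hasPd_three 0 0 0 1).congr_left o3 hu
  have hq1 := HasPd.congr_left
    ((((((((((((hs.hasPd_one 0 0 0 1).mul (hs.hasPd_one 1 0 1 1)).const_mul 2).sub
      ((hs.hasPd_one 0 (-1) 1 1).const_mul g)).sub
      ((hs.hasPd_one 0 0 1 0).const_mul (2 * g))).sub
      ((hs.hasPd_one 0 1 1 (-1)).const_mul g)).sub
      (((hs.hasPd_one 0 0 1 0).mul (hs.hasPd_one 0 1 1 1)).const_mul 2)).sub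
      ((hs.hasPd_one 0 0 1 1).mul (hs.hasPd_one 0 0 1 1))).add
      (hs.hasPd_one 0 0 1 2)).sub
      ((hs.hasPd_one 0 1 1 0).mul (hs.hasPd_one 0 1 1 0))).add
      ((hs.hasPd_one 0 1 1 1).const_mul 2)).add
      (hs.hasPd_one 0 2 1 0)) o1 hq
  have hv1 := (((HasPd.const 1).add (hs.hasPd_one_v.const_mul g⁻¹)).congr_left o1 hv).congr
    fun y _ => zero_add _
  have hv11 := hv1.pd (hs.hasPd_one_one_v.const_mul g⁻¹) o1
  have hv111 := hv11.pd (HasPd.const_mul g⁻¹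
    (((((((((((hs.hasPd_one 0 0 0 1).mul (hs.hasPd_one 0 0 0 1)).const_mul (2 * g)).sub
      ((hs.hasPd_one 0 0 1 1).const_mul g)).add
      ((hs.hasPd_one 0 1 1 0).const_mul g)).add
      ((((hs.hasPd_one 0 0 0 1).mul (hs.hasPd_one 0 0 0 1)).mul (hs.hasPd_one 0 1 1 1)).const_mul 2)).sub
      (((hs.hasPd_one 0 0 0 1).mul (hs.hasPd_one 0 1 0 2)).const_mul 2)).sub
      ((hs.hasPd_one 0 0 1 1).mul (hs.hasPd_one 0 1 1 1))).add
      ((hs.hasPd_one 0 1 1 0).mul (hs.hasPd_one 0 1 1 1))).add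
      (hs.hasPd_one 0 1 1 2)).sub
      (hs.hasPd_one 0 2 1 1))) o1
  have hv2 := (((HasPd.const 1).add (hs.hasPd_two_v.const_mul g⁻¹)).congr_left o2 hv).congr
    fun y _ => zero_add _
  have hv21 := hv2.pd (HasPd.const_mul g⁻¹
    ((((((hs.hasPd_one 0 1 1 2).add
      (hs.hasPd_one 0 2 1 1)).sub
      ((hs.hasPd_one 0 0 1 1).const_mul g)).sub
      ((hs.hasPd_one 0 1 1 0).const_mul g)).sub
      ((hs.hasPd_one 0 0 1 1).mul (hs.hasPd_one 0 1 1 1))).sub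
      ((hs.hasPd_one 0 1 1 0).mul (hs.hasPd_one 0 1 1 1)))) o1
  have hv3 := ((HasPd.const 1).add ((hs.hasPd_three 0 1 1 1).const_mul g⁻¹)).congr_left o3 hv
  have hw1 := (((HasPd.const 1).sub hs.hasPd_one_w).congr_left o1 hw).congr
    fun y _ => zero_sub _
  have hw11 := hw1.pd hs.hasPd_one_one_w.neg o1
  have hw111 := hw11.pd (HasPd.neg
    (((((((((((hs.hasPd_one 0 (-1) 0 0).mul (hs.hasPd_one 0 0 0 1)).const_mul (2 * g)).sub
      ((hs.hasPd_one 0 (-1) 1 0).const_mul g)).add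
      ((hs.hasPd_one 0 0 1 (-1)).const_mul g)).sub
      (((hs.hasPd_one 0 0 0 1).mul (hs.hasPd_one 0 0 0 1)).const_mul 2)).add
      ((((hs.hasPd_one 0 0 0 1).mul (hs.hasPd_one 0 0 0 1)).mul (hs.hasPd_one 0 0 1 0)).const_mul 2)).sub
      ((hs.hasPd_one 0 0 1 0).mul (hs.hasPd_one 0 0 1 1))).add
      ((hs.hasPd_one 0 0 1 0).mul (hs.hasPd_one 0 1 1 0))).add
      (hs.hasPd_one 0 0 1 1)).sub
      (hs.hasPd_one 0 1 1 0))) o1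
  have hw2 := (((HasPd.const 1).sub hs.hasPd_two_w).congr_left o2 hw).congr
    fun y _ => zero_sub _
  have hw21 := hw2.pd (HasPd.neg
    ((((((hs.hasPd_one 0 0 1 1).add
      (hs.hasPd_one 0 1 1 0)).sub
      ((hs.hasPd_one 0 (-1) 1 0).const_mul g)).sub
      ((hs.hasPd_one 0 0 1 (-1)).const_mul g)).sub
      ((hs.hasPd_one 0 0 1 0).mul (hs.hasPd_one 0 0 1 1))).sub
      ((hs.hasPd_one 0 0 1 0).mul (hs.hasPd_one 0 1 1 0)))) o1
  have hw3 := ((HasPd.const 1).sub (hs.hasPd_three 0 0 1 0)).congr_left o3 hw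
  refine ⟨hau, hav, haw, haq, ?_, ?_, ?_, ?_⟩
  · rw [hq1.pd_eq hx, hu22.pd_eq hx]
    simp only [hs.reduce_two hx, hs.reduce_three hx, hs.reduce_two_right hx,
      hs.reduce_three_right hx, hs.reduce_four_right hx, hs.skew_one_zero hx, hs.skew_of_lt hx,
      hs.skew_self hx, Nat.reduceAdd, Int.reduceAdd, Int.reduceSub, Int.reduceNeg, Int.reduceLT]
    ring
  · rw [hu3.pd_eq hx, hu111.pd_eq hx, hu1.pd_eq hx, hq x hx, hv x hx, hw x hx]
    simp only [hs.reduce_two hx, hs.reduce_three hx, hs.reduce_two_right hx,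
      hs.reduce_three_right hx, hs.reduce_four_right hx, hs.skew_one_zero hx, hs.skew_of_lt hx,
      hs.skew_self hx, Nat.reduceAdd, Int.reduceAdd, Int.reduceSub, Int.reduceNeg, Int.reduceLT]
    linear_combination (3 * s 0 1 1 1 x * (1 - s 0 0 1 0 x)) * hg1
  · rw [hv3.pd_eq hx, hv111.pd_eq hx, hu1.pd_eq hx, hv1.pd_eq hx, hv21.pd_eq hx, hu2.pd_eq hx,
      hv x hx]
    simp only [hs.reduce_two hx, hs.reduce_three hx, hs.reduce_two_right hx,
      hs.reduce_three_right hx, hs.reduce_four_right hx, hs.skew_one_zero hx, hs.skew_of_lt hx,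
      hs.skew_self hx, Nat.reduceAdd, Int.reduceAdd, Int.reduceSub, Int.reduceNeg, Int.reduceLT]
    generalize g⁻¹ = i at hg1 ⊢
    linear_combination 3 * (s 0 0 0 2 x - g * s 0 (-1) 0 1 x - s 0 0 0 1 x * s 0 0 1 1 x
      - s 0 0 0 1 x * s 0 1 1 0 x) * hg1
  · rw [hw3.pd_eq hx, hw111.pd_eq hx, hu1.pd_eq hx, hw1.pd_eq hx, hw21.pd_eq hx, hu2.pd_eq hx,
      hw x hx]
    simp only [hs.reduce_two hx, hs.reduce_three hx, hs.reduce_two_right hx,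
      hs.reduce_three_right hx, hs.reduce_four_right hx, hs.skew_one_zero hx, hs.skew_of_lt hx,
      hs.skew_self hx, Nat.reduceAdd, Int.reduceAdd, Int.reduceSub, Int.reduceNeg, Int.reduceLT]
    ring

end PairingRules

end EllKP

namespace EllKP

theorem setTimes_self (x : ℕ → ℂ) : setTimes x ![x 1, x 2, x 3] = x := by
  simp [setTimes]

variable {N : ℕ} {e g : ℂ} {k K : Fin N → ℂ} {c : Matrix (Fin N) (Fin N) ℂ} {n : ℤ} {x : ℕ → ℂ}

theorem phaseSummable_setTimes {k K : ℂ} (hx : PhaseSummable g k K x) (t : Fin 3 → ℂ) :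
    PhaseSummable g k K (setTimes x t) :=
  (isPhaseRate_three g k K _
    (isPhaseRate_two g k K _ (isPhaseRate_one g k K x hx (t 0)).1 (t 1)).1 (t 2)).1

theorem matR_setTimes (hx : ∀ ν, PhaseSummable g (k ν) (K ν) x) (t : Fin 3 → ℂ) (μ ν : Fin N) :
    matR g k K c n (setTimes x t) μ ν
      = Complex.exp ((k μ ^ 3 + k ν ^ 3) * (t 2 - x 3)) *
        (Complex.exp ((K μ - g / K μ + (K ν - g / K ν)) * (t 1 - x 2)) *
          (Complex.exp ((k μ + k ν) * (t 0 - x 1)) * matR g k K c n x μ ν)) := by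
  have h1 := fun ν => (isPhaseRate_one g (k ν) (K ν) x (hx ν) (t 0)).1
  have h2 := fun ν => (isPhaseRate_two g (k ν) (K ν) _ (h1 ν) (t 1)).1
  rw [setTimes, matR_update (fun ν => isPhaseRate_three g (k ν) (K ν)) h2,
    matR_update (fun ν => isPhaseRate_two g (k ν) (K ν)) h1,
    matR_update (fun ν => isPhaseRate_one g (k ν) (K ν)) hx]
  simp

theorem analyticAt_matR_setTimes (hx : ∀ ν, PhaseSummable g (k ν) (K ν) x) (t : Fin 3 → ℂ)
    (μ ν : Fin N) : AnalyticAt ℂ (fun t => matR g k K c n (setTimes x t) μ ν) t := by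
  have hexp : ∀ (a b : ℂ) (i : Fin 3),
      AnalyticAt ℂ (fun t : Fin 3 → ℂ => Complex.exp (a * (t i - b))) t := fun a b i =>
    (analyticAt_const.mul (((ContinuousLinearMap.proj (R := ℂ) (φ := fun _ : Fin 3 => ℂ)
      i).analyticAt t).sub analyticAt_const)).cexp
  simp only [matR_setTimes hx]
  exact (hexp _ _ 2).mul ((hexp _ _ 1).mul ((hexp _ _ 0).mul analyticAt_const))

theorem eventually_setTimes_mem (hx : x ∈ regularSet g k K c n) :
    ∀ᶠ t in 𝓝 ![x 1, x 2, x 3], setTimes x t ∈ regularSet g k K c n := by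
  have h := (analyticAt_det (analyticAt_matA (analyticAt_matR_setTimes (c := c) (n := n) hx.1
    ![x 1, x 2, x 3]))).continuousAt
  filter_upwards [h.eventually_ne (y := 0) (by rw [setTimes_self]; exact hx.2)] with t ht using
    ⟨fun ν => phaseSummable_setTimes (hx.1 ν) t, ht⟩

theorem AnalyticAtTimes.congr {F G : (ℕ → ℂ) → ℂ} (hF : AnalyticAtTimes F x)
    (hx : x ∈ regularSet g k K c n) (h : ∀ y ∈ regularSet g k K c n, G y = F y) :
    AnalyticAtTimes G x :=
  AnalyticAt.congr hF <| by
    filter_upwards [eventually_setTimes_mem hx] with t ht using (h _ ht).symm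

theorem analyticAtTimes_pairing (hx : x ∈ regularSet g k K c n) (a : ℕ) (b : ℤ) (a' : ℕ) (b' : ℤ) :
    AnalyticAtTimes (pairing g k K c n a b a' b') x := by
  have hS := analyticAt_matS (analyticAt_matR_setTimes hx.1 ![x 1, x 2, x 3])
    (by rw [setTimes_self]; exact hx.2)
  change AnalyticAt ℂ (fun t => ∑ μ, mono k K a b μ *
    ∑ ν, matS g k K c n (setTimes x t) μ ν * mono k K a' b' ν) _
  exact Finset.analyticAt_fun_sum _ fun μ _ => analyticAt_const.mul
    (Finset.analyticAt_fun_sum _ fun ν _ => (hS μ ν).mul analyticAt_const)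

theorem mono_zero_zero : mono k K 0 0 = vec0 := by
  ext; simp [mono, vec0]

theorem mono_one_zero : mono k K 1 0 = vec1 k := by
  ext; simp [mono, vec1]

theorem mono_zero_one : mono k K 0 1 = vec2 K := by
  ext; simp [mono, vec2]

theorem mono_one_one : mono k K 1 1 = vec3 k K := by
  ext; simp [mono, vec3]

theorem hasPd_two_logDeriv_tauSq
    (hs : PairingRules e g (regularSet g k K c n) (pairing g k K c n))
    (hτ : HasPd (regularSet g k K c n) 2 (tauSq g k K c n) fun y =>
      2 * tauSq g k K c n y * (pairing g k K c n 0 1 1 0 y - pairing g k K c n 1 1 0 0 y))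
    {F : (ℕ → ℂ) → ℂ}
    (hF : HasPd (regularSet g k K c n) 2
      (fun y => pairing g k K c n 0 1 1 0 y + pairing g k K c n 0 0 1 1 y) F) :
    HasPd (regularSet g k K c n) 2
      (fun y => pd 2 (tauSq g k K c n) y / (2 * tauSq g k K c n y)) F := by
  refine hF.congr_left hs.open_two fun y hy => ?_
  have h0 : tauSq g k K c n y ≠ 0 := hy.2
  rw [hτ.pd_eq hy, hs.skew_one_zero hy]
  field_simp
  ring

end EllKP

theorem mainTheorem4 (N : ℕ) (e g : ℂ) (hg : g ≠ 0) (k K : Fin N → ℂ)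
    (hK : ∀ ν, K ν ≠ 0)
    (hcurve : ∀ ν, k ν ^ 2 = K ν + 3 * e + g / K ν)
    (hdistinct : Function.Injective fun ν => (k ν, K ν))
    (hkernel : ∀ μ ν, μ ≠ ν → k μ + k ν ≠ 0 ∨ K μ * K ν ≠ g)
    (c : Matrix (Fin N) (Fin N) ℂ) (hc : ∀ μ ν, c μ ν = -c ν μ)
    (n : ℤ) (x : ℕ → ℂ)
    (hx : ∀ ν, EllKP.PhaseSummable g (k ν) (K ν) x)
    (hdet : (EllKP.matA g k K c n x).det ≠ 0) :
    EllKP.SolvesAt e g (EllKP.solU g k K c n) (EllKP.solV g k K c n) (EllKP.solW g k K c n)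
      (EllKP.solQ g k K c n) x := by
  have hs := EllKP.pairingRules (n := n) hK hcurve hkernel hc
  have hτ := EllKP.hasPd_tauSq_two (n := n) hK hcurve hkernel hc
  have hmem : x ∈ EllKP.regularSet g k K c n := ⟨hx, hdet⟩
  have ha := EllKP.analyticAtTimes_pairing hmem
  have hu : ∀ y ∈ EllKP.regularSet g k K c n,
      EllKP.solU g k K c n y = EllKP.pairing g k K c n 0 0 0 1 y := fun y hy => by
    rw [hs.skew 0 0 0 1 y hy, EllKP.pairing, EllKP.mono_zero_one, EllKP.mono_zero_zero]
    rfl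
  have hv : ∀ y ∈ EllKP.regularSet g k K c n,
      EllKP.solV g k K c n y = 1 + g⁻¹ * EllKP.pairing g k K c n 0 1 1 1 y := fun y hy => by
    rw [hs.skew 0 1 1 1 y hy, EllKP.pairing, EllKP.mono_zero_one, EllKP.mono_one_one, mul_neg,
      ← sub_eq_add_neg]
    rfl
  have hw : ∀ y ∈ EllKP.regularSet g k K c n,
      EllKP.solW g k K c n y = 1 - EllKP.pairing g k K c n 0 0 1 0 y := fun y hy => by
    rw [hs.skew 0 0 1 0 y hy, EllKP.pairing, EllKP.mono_zero_zero, EllKP.mono_one_zero,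
      sub_neg_eq_add]
    rfl
  have hq := fun y hy =>
    (EllKP.hasPd_two_logDeriv_tauSq hs hτ hs.hasPd_two_logTau).pd_eq (y := y) hy
  have ha' : ∀ a b a' b', AnalyticAt ℂ
    (fun t => EllKP.pairing g k K c n a b a' b' (EllKP.setTimes x t)) ![x 1, x 2, x 3] := ha
  refine hs.solvesAt hg hmem ((ha 0 0 0 1).congr hmem hu) ?_ ?_ ?_ hu hv hw hq
  · refine EllKP.AnalyticAtTimes.congr ?_ hmem hv
    unfold EllKP.AnalyticAtTimes
    fun_prop
  · refine EllKP.AnalyticAtTimes.congr ?_ hmem hw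
    unfold EllKP.AnalyticAtTimes
    fun_prop
  · refine EllKP.AnalyticAtTimes.congr ?_ hmem hq
    unfold EllKP.AnalyticAtTimes
    fun_prop
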